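/- **Setting.** Let $\Delta$ be a quantifier-free formula of linear real arithmetic over $x_1,\dots,x_n\in\mathbb R$ in conjunctive normal form. Its literals are atoms $\sum_i a_ix_i\le b$ or $\sum_i a_ix_i=b$ or their negations, and each clause contains exactly one or two variables. Let $p(x)=\prod_S p_S(x_S)$ be an unnormalized density whose factors have scopes $S$ with $|S|\in\{1,2\}$ and belong to $W_{PP}$: there are finitely many pairwise disjoint polytopes $\Phi_1,\dots,\Phi_k$, each given by a conjunction of literals over $x_S$, with $p_S(x_S)=\prod_{s\in S}q_h^s(x_s)\ge 0$ on $\Phi_h$, where the $q_h^s$ are univariate polynomials. The global graph $G$ on the variables joins $x_i$ and $x_j$ if $\{x_i,x_j\}$ is the variable set of a clause or the scope of a density factor; assume that $G$ is a forest. For $S$ a single variable or an edge of $G$, let $\Delta_S$ be the conjunction of the clauses with variable set $S$ ($\mathrm{True}$ if there is none), put $p_S=1$ if the density has no factor of scope $S$, and let $f_S=[x_S\models\Delta_S]\cdot p_S(x_S)$. **Algorithm.** MpMap roots every tree of $G$ at an arbitrary vertex and sends, from the leaves to the roots, univariate piecewise polynomials, which are undefined where infeasible: the message $m_{f_i\to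 X_i}=f_i$; the message $m_{X_i\to f_{ij}}$ to the factor shared with the parent $j$ (for a root: the final message), which is the pointwise product of $f_i$ and the messages $m_{f_{ci}\to X_i}$ of the children $c$; and $m_{f_{ij}\to X_j}(x_j)=\sup_{x_i}f_{ij}(x_i,x_j)\,m_{X_i\to f_{ij}}(x_i)$. The latter is computed as follows. Cut the $x_j$-axis at the critical points, namely the crossings of the boundary lines of the literals of $f_{ij}$ and of the lines given by the overall bounds of the domain of $m_{X_i\to f_{ij}}$, together with the bounds from literals in $x_j$ alone. Over each critical interval, for each feasible region between or on consecutive boundary lines, with active piece $q^i(x_i)q^j(x_j)$ of $p_{ij}$, form $q^j$ times the symbolic maximum (max-out) of $q^i\,m_{X_i\to f_{ij}}$ between the affine bounds of that region. Finally take the pointwise maximum of the resulting piecewise polynomials. Max-out of a piecewise polynomial $q$ between bounds $l(y)$ and $u(y)$ breaks the $y$-axis at the preimages under $l$ and $u$ of the extreme and boundary points of $q$, at the roots of $q\circ u-q\circ l$, at the crossing of $l$ and $u$, and at the at most one crossing, in each interval so obtained, of the dominating one of $q\circ l$, $q\circ u$ with the constant inner maximum. **Theorem.** Let $c$ be the maximum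 of $1$ and the largest number of literals in a factor $f_S$ (those of $\Delta_S$ and those of the polytopes of $p_S$), $d$ the diameter of $G$ (the largest distance between two vertices of the same component), and $q_{\max}$ the maximum of $1$ and the largest degree of a univariate polynomial $q_h^s$. Then the total number of pieces of all messages generated during MpMap is $$O\!\left(c^{5d+1}\,(n-d)^{2d}\,q_{\max}^{2d}\,(2n)^{d+1}\,(d!)^2\right),$$ where the implied constant is absolute: it does not depend on $n$, $d$, $c$, $q_{\max}$, the problem or the choice of the roots. -/

import Mathlib

namespace MpMap

noncomputable section

open scoped Classical

/-! ### Constraints: linear real arithmetic in conjunctive normal form -/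

/-- The comparison symbols of linear atoms. -/
inductive Cmp
  | le
  | eq

/-- A literal over the real variables `x 0, …, x (n-1)`: a linear atom
`∑ i, coef i * x i ≤ rhs` or `∑ i, coef i * x i = rhs`, possibly negated. -/
structure Literal (n : ℕ) where
  coef : Fin n → ℝ
  cmp : Cmp
  rhs : ℝ
  negated : Bool

variable {n : ℕ}

/-- Truth of the underlying atom of a literal at an assignment. -/
def Literal.AtomHolds (l : Literal n) (x : Fin n → ℝ) : Prop :=
  match l.cmp with
  | Cmp.le => ∑ i, l.coef i * x i ≤ l.rhs
  | Cmp.eq => ∑ i, l.coef i * x i = l.rhs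

/-- Truth of a literal at an assignment. -/
def Literal.Holds (l : Literal n) (x : Fin n → ℝ) : Prop :=
  if l.negated = true then ¬ l.AtomHolds x else l.AtomHolds x

/-- The variables that appear in a list of literals. -/
def litVars (c : List (Literal n)) : Finset (Fin n) :=
  Finset.univ.filter fun i => ∃ l ∈ c, l.coef i ≠ 0

/-- A clause, i.e. the disjunction of a list of literals. -/
abbrev Clause (n : ℕ) := List (Literal n)

def clauseHolds (c : Clause n) (x : Fin n → ℝ) : Prop := ∃ l ∈ c, l.Holds x

/-! ### Weights: piecewise separable polynomials -/

/-- One piece of a piecewise separable polynomial: on the polytope described by the conjunction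
`guard` of literals, the value is the product over the variables `s` of the scope of the
univariate polynomials `fac s`. -/
structure SepPiece (n : ℕ) where
  guard : List (Literal n)
  fac : Fin n → Polynomial ℝ

def SepPiece.Sat (k : SepPiece n) (x : Fin n → ℝ) : Prop := ∀ l ∈ k.guard, l.Holds x

/-- The family of piecewise separable non-negative polynomials in the variables `S`: finitely
many non-overlapping polytopes over `S`, each of them with a product of univariate
polynomials. -/
structure PPWeight (S : Finset (Fin n)) where
  pieces : List (SepPiece n)
  guard_vars : ∀ k ∈ pieces, litVars k.guard ⊆ S
  disjoint : pieces.Pairwise fun k k' => ∀ x, ¬ (k.Sat x ∧ k'.Sat x)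
  nonneg : ∀ k ∈ pieces, ∀ x, k.Sat x → 0 ≤ ∏ s ∈ S, (k.fac s).eval (x s)

/-! ### The constrained MAP problem and its factors -/

/-- A constrained MAP problem: a formula in conjunctive normal form with univariate and bivariate
clauses, and an unnormalized density that is a product of univariate and bivariate piecewise
separable polynomials. `weight S = none` means that the density has no factor of scope `S`. -/
structure Problem (n : ℕ) where
  formula : List (Clause n)
  clause_scope : ∀ c ∈ formula, (litVars c).card = 1 ∨ (litVars c).card = 2
  weight : (S : Finset (Fin n)) → Option (PPWeight S)
  weight_scope : ∀ S, (weight S).isSome = true → S.card = 1 ∨ S.card = 2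

/-- The global graph: `i` and `j` are adjacent when they are the variables of a bivariate clause
or of a bivariate factor of the density. -/
def Problem.graph (P : Problem n) : SimpleGraph (Fin n) where
  Adj i j := i ≠ j ∧
    ((∃ c ∈ P.formula, litVars c = {i, j}) ∨ (P.weight {i, j}).isSome = true)
  symm := ⟨fun i j h => by rw [Finset.pair_comm j i]; exact ⟨h.1.symm, h.2⟩⟩
  loopless := ⟨fun _ h => h.1 rfl⟩

/-- The scopes of the factors: all single variables and all edges of the global graph. -/
def Problem.factors (P : Problem n) : Finset (Finset (Fin n)) :=
  Finset.univ.filter fun S => (∃ i, S = {i}) ∨ ∃ i j, P.graph.Adj i j ∧ S = {i, j}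

/-- The restriction of the formula to the clauses over `S` (no clause: `True`). -/
def Problem.clausesOn (P : Problem n) (S : Finset (Fin n)) : List (Clause n) :=
  P.formula.filter fun c => litVars c = S

/-- The pieces of the density factor of scope `S`, which is the constant `1` if absent. -/
def Problem.piecesOn (P : Problem n) (S : Finset (Fin n)) : List (SepPiece n) :=
  match P.weight S with
  | some w => w.pieces
  | none => [⟨[], fun _ => 1⟩]

/-- All literals of the factor of scope `S`, from its clauses and from the polytopes of its
density pieces. -/
def Problem.literals (P : Problem n) (S : Finset (Fin n)) : List (Literal n) :=
  (P.clausesOn S).flatten ++ (P.piecesOn S).flatMap SepPiece.guard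

/-- The size of the formula attached to the factor of scope `S`: its number of literals. -/
def Problem.size (P : Problem n) (S : Finset (Fin n)) : ℕ := (P.literals S).length

/-- The maximal formula size over all factors. -/
def Problem.maxSize (P : Problem n) : ℕ := P.factors.sup P.size

/-- The maximal degree of the univariate polynomials in the density. -/
def Problem.maxDegree (P : Problem n) : ℕ :=
  P.factors.sup fun S =>
    ((P.piecesOn S).map fun k => S.sup fun s => (k.fac s).natDegree).foldr max 0

/-- The diameter of a graph, i.e. the largest distance between two vertices of the same connected
component (`SimpleGraph.dist` is zero between different components). -/
def diameter (G : SimpleGraph (Fin n)) : ℕ :=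
  Finset.univ.sup fun p : Fin n × Fin n => G.dist p.1 p.2

/-- The density piece of the factor `S` that is active at `x`, provided that `x` satisfies the
clauses over `S`; `none` if the factor vanishes at `x`. -/
def Problem.active (P : Problem n) (S : Finset (Fin n)) (x : Fin n → ℝ) :
    Option (SepPiece n) :=
  if ∀ c ∈ P.clausesOn S, clauseHolds c x then (P.piecesOn S).find? fun k => k.Sat x else none

/-! ### Univariate piecewise polynomials -/

/-- An interval of reals, bounded or not, each of its ends being open or closed. -/
structure Ival where
  lo : EReal
  loClosed : Bool
  hi : EReal
  hiClosed : Bool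

def Ival.Mem (I : Ival) (x : ℝ) : Prop :=
  (if I.loClosed = true then I.lo ≤ (x : EReal) else I.lo < (x : EReal)) ∧
    (if I.hiClosed = true then (x : EReal) ≤ I.hi else (x : EReal) < I.hi)

/-- Some point of the interval. -/
def Ival.sample (I : Ival) : ℝ := if h : ∃ x, I.Mem x then h.choose else 0

/-- The intersection of two intervals. -/
def Ival.inter (I J : Ival) : Ival where
  lo := max I.lo J.lo
  loClosed :=
    if I.lo < J.lo then J.loClosed else if J.lo < I.lo then I.loClosed
    else I.loClosed && J.loClosed
  hi := min I.hi J.hi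
  hiClosed :=
    if I.hi < J.hi then I.hiClosed else if J.hi < I.hi then J.hiClosed
    else I.hiClosed && J.hiClosed

/-- The cells `(a, b₁), {b₁}, (b₁, b₂), {b₂}, …, (bₖ, ∞)` for a sorted list `b₁, …, bₖ`. -/
def cellsFrom (a : EReal) : List ℝ → List Ival
  | [] => [⟨a, false, ⊤, false⟩]
  | b :: bs => ⟨a, false, b, false⟩ :: ⟨b, true, b, true⟩ :: cellsFrom b bs

/-- The partition of the real line into the points of `B` and the open intervals between them. -/
def cells (B : Finset ℝ) : List Ival := cellsFrom ⊥ (B.sort (· ≤ ·))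

/-- A piece of a univariate piecewise polynomial. -/
structure Piece where
  dom : Ival
  poly : Polynomial ℝ

/-- A univariate piecewise polynomial as a data structure: the list of its pieces from left to
right. It is undefined outside of the pieces. -/
abbrev PiecewisePoly := List Piece

/-- The real number given by a finite extended real. -/
def finitePart (e : EReal) : Option ℝ := if e = ⊥ ∨ e = ⊤ then none else some e.toReal

/-- The boundary points of the pieces. -/
def breaks (q : PiecewisePoly) : Finset ℝ :=
  (q.flatMap fun p => [p.dom.lo, p.dom.hi].filterMap finitePart).toFinset

/-- The extreme points of the pieces (roots of the derivative). -/
def extremePoints (q : PiecewisePoly) : Finset ℝ :=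
  (q.flatMap fun p => (p.poly.derivative.roots.toFinset.filter p.dom.Mem).toList).toFinset

/-- The polynomial of the piece that contains `x`. -/
def polyAt (q : PiecewisePoly) (x : ℝ) : Option (Polynomial ℝ) :=
  (q.find? fun p => p.dom.Mem x).map Piece.poly

/-- The polynomial of the piece that lies immediately to the right of `x`. -/
def polyRight (q : PiecewisePoly) (x : ℝ) : Option (Polynomial ℝ) :=
  (q.find? fun p => p.dom.lo ≤ (x : EReal) ∧ (x : EReal) < p.dom.hi).map Piece.poly

/-- The polynomial of the piece that lies immediately to the left of `x`. -/
def polyLeft (q : PiecewisePoly) (x : ℝ) : Option (Polynomial ℝ) :=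
  (q.find? fun p => p.dom.lo < (x : EReal) ∧ (x : EReal) ≤ p.dom.hi).map Piece.poly

/-- Multiplication of all pieces by a polynomial. -/
def scale (r : Polynomial ℝ) (q : PiecewisePoly) : PiecewisePoly :=
  q.map fun p => ⟨p.dom, r * p.poly⟩

/-- Restriction to an interval. -/
def restrictTo (I : Ival) (q : PiecewisePoly) : PiecewisePoly :=
  (q.map fun p => (⟨I.inter p.dom, p.poly⟩ : Piece)).filter fun p => ∃ x, p.dom.Mem x

/-- Joins consecutive pieces that touch each other and carry the same polynomial. -/
def simplify : PiecewisePoly → PiecewisePoly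
  | [] => []
  | p :: ps =>
    match simplify ps with
    | [] => [p]
    | r :: rs =>
      if p.poly = r.poly ∧ p.dom.hi = r.dom.lo ∧
          (p.dom.hiClosed = true ∨ r.dom.loClosed = true) then
        ⟨⟨p.dom.lo, p.dom.loClosed, r.dom.hi, r.dom.hiClosed⟩, p.poly⟩ :: rs
      else p :: r :: rs

/-- The piecewise polynomial with break points in `B` that carries the polynomial `f y` on the
cell containing `y`, and is undefined there if `f y = none`; `f` is queried at one point of each
cell. -/
def assemble (B : Finset ℝ) (f : ℝ → Option (Polynomial ℝ)) : PiecewisePoly :=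
  simplify ((cells B).filterMap fun I => (f I.sample).map fun p => ⟨I, p⟩)

/-- The polynomial in the list that has the largest value at `y`. -/
def dominating (L : List (Polynomial ℝ)) (y : ℝ) : Option (Polynomial ℝ) :=
  L.argmax fun p => p.eval y

/-! ### The symbolic maximum -/

/-- The affine function `y ↦ slope * y + icpt`. -/
structure Affine where
  slope : ℝ
  icpt : ℝ

def Affine.eval (a : Affine) (y : ℝ) : ℝ := a.slope * y + a.icpt

def Affine.toPoly (a : Affine) : Polynomial ℝ :=
  Polynomial.C a.slope * Polynomial.X + Polynomial.C a.icpt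

/-- The preimage of a finite set under an affine function, empty if the function is constant. -/
def Affine.preimage (a : Affine) (B : Finset ℝ) : Finset ℝ :=
  if a.slope = 0 then ∅ else B.image fun b => (b - a.icpt) / a.slope

/-- The point where two non-parallel affine functions agree. -/
def Affine.cross (a b : Affine) : Option ℝ :=
  if a.slope = b.slope then none else some ((b.icpt - a.icpt) / (a.slope - b.slope))

/-- A region of the plane over which `x` is maximized for fixed `y`: either the strip
`l y < x < u y`, where an absent bound is infinite, or the line `x = a y`. A closed region
`l y ≤ x ≤ u y` is the union of a strip and two lines. -/
inductive Window
  | strip (l u : Option Affine)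
  | line (a : Affine)

def Window.Mem (w : Window) (y x : ℝ) : Prop :=
  match w with
  | Window.strip l u => (∀ a ∈ l, a.eval y < x) ∧ (∀ a ∈ u, x < a.eval y)
  | Window.line a => x = a.eval y

/-- Some `x` in the window over `y`. -/
def Window.sample (w : Window) (y : ℝ) : ℝ := if h : ∃ x, w.Mem y x then h.choose else 0

def preimageOpt (a : Option Affine) (B : Finset ℝ) : Finset ℝ :=
  match a with
  | none => ∅
  | some a => a.preimage B

/-- The limit of `q` at the lower end of the strip, as a polynomial in `y` near a given `y`. At
`-∞` only a constant piece has a finite limit. -/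
def lowerEnd (q : PiecewisePoly) (l : Option Affine) (y : ℝ) : Option (Polynomial ℝ) :=
  match l with
  | some a => (polyRight q (a.eval y)).map fun p => p.comp a.toPoly
  | none => (q.find? fun p => p.dom.lo = ⊥ ∧ p.poly.natDegree = 0).map Piece.poly

/-- The limit of `q` at the upper end of the strip. -/
def upperEnd (q : PiecewisePoly) (u : Option Affine) (y : ℝ) : Option (Polynomial ℝ) :=
  match u with
  | some a => (polyLeft q (a.eval y)).map fun p => p.comp a.toPoly
  | none => (q.find? fun p => p.dom.hi = ⊤ ∧ p.poly.natDegree = 0).map Piece.poly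

/-- The limits at both ends, if the strip is non-empty over `y`. -/
def endPolys (q : PiecewisePoly) (l u : Option Affine) (y : ℝ) : List (Polynomial ℝ) :=
  if ∃ x, (Window.strip l u).Mem y x then
    [lowerEnd q l y, upperEnd q u y].filterMap id
  else []

/-- The largest value of `q`, one-sided limits included, at the extreme points and boundary
points of `q` inside of the strip over `y`. -/
def innerMax (q : PiecewisePoly) (l u : Option Affine) (y : ℝ) : Option ℝ :=
  ((((extremePoints q ∪ breaks q).filter ((Window.strip l u).Mem y)).toList.flatMap fun b =>
    ([polyLeft q b, polyAt q b, polyRight q b].filterMap id).map fun p => p.eval b)).max?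

/-- Break points that come from extreme points and boundary points of `q` entering or leaving the
strip. -/
def breaksEnter (q : PiecewisePoly) (l u : Option Affine) : Finset ℝ :=
  preimageOpt l (extremePoints q ∪ breaks q) ∪ preimageOpt u (extremePoints q ∪ breaks q)

/-- The point where the strip begins or ends to be non-empty. -/
def breaksBounds (l u : Option Affine) : Finset ℝ :=
  (l.bind fun a => u.bind fun b => a.cross b).toFinset

/-- The points where the limits of `q` at the two ends of the strip change their order: the roots
of the piecewise polynomial `q ∘ u - q ∘ l`. -/
def breaksSwitch (q : PiecewisePoly) (l u : Option Affine) : Finset ℝ :=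
  ((cells (preimageOpt l (breaks q) ∪ preimageOpt u (breaks q) ∪ breaksBounds l u)).flatMap
    fun I => match endPolys q l u I.sample with
      | [p, r] => ((p - r).roots.toFinset.filter I.Mem).toList
      | _ => []).toFinset

def breaksOuter (q : PiecewisePoly) (l u : Option Affine) : Finset ℝ :=
  breaksEnter q l u ∪ breaksSwitch q l u ∪ breaksBounds l u

/-- In each cell between the previous break points, the dominating polynomial at the ends of the
strip is monotone and the inner maximum is constant. This is the point where they cross. -/
def breaksCross (q : PiecewisePoly) (l u : Option Affine) : Finset ℝ :=
  ((cells (breaksOuter q l u)).filterMap fun I =>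
    match dominating (endPolys q l u I.sample) I.sample, innerMax q l u I.sample with
    | some p, some e =>
      if h : p ≠ Polynomial.C e ∧ ∃ z, I.Mem z ∧ p.eval z = e then some h.2.choose else none
    | _, _ => none).toFinset

/-- The algorithm `max-out`: the piecewise polynomial `y ↦ sup q(x)`, the supremum being over the
`x` in the window over `y`. -/
def maxOut (q : PiecewisePoly) (w : Window) : PiecewisePoly :=
  match w with
  | Window.strip l u =>
    assemble (breaksOuter q l u ∪ breaksCross q l u) fun y =>
      dominating (endPolys q l u y ++ ((innerMax q l u y).map Polynomial.C).toList) y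
  | Window.line a =>
    assemble (a.preimage (breaks q)) fun y =>
      (polyAt q (a.eval y)).map fun p => p.comp a.toPoly

/-! ### Pointwise product and pointwise maximum -/

def allBreaks (Q : List PiecewisePoly) : Finset ℝ := (Q.flatMap fun q => (breaks q).toList).toFinset

/-- The pointwise product of piecewise polynomials, undefined where one of them is. -/
def gatherMsgs (Q : List PiecewisePoly) : PiecewisePoly :=
  assemble (allBreaks Q) fun y =>
    Q.foldr (fun q acc => (polyAt q y).bind fun p => acc.map fun r => p * r) (some 1)

/-- The points where the order of two of the given piecewise polynomials changes. -/
def pairRoots (Q : List PiecewisePoly) : Finset ℝ :=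
  ((cells (allBreaks Q)).flatMap fun I =>
    (Q.filterMap fun q => polyAt q I.sample).flatMap fun p =>
      (Q.filterMap fun q => polyAt q I.sample).flatMap fun r =>
        ((p - r).roots.toFinset.filter I.Mem).toList).toFinset

/-- The pointwise maximum of piecewise polynomials, over those that are defined. -/
def maxPieces (Q : List PiecewisePoly) : PiecewisePoly :=
  assemble (allBreaks Q ∪ pairRoots Q) fun y => dominating (Q.filterMap fun q => polyAt q y) y

/-! ### The messages -/

/-- The univariate factor of variable `i`, which is the message from this factor to `i`. -/
def Problem.unaryMsg (P : Problem n) (i : Fin n) : PiecewisePoly :=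
  assemble
    ((((P.literals {i}).filter fun l => l.coef i ≠ 0).map fun l => l.rhs / l.coef i).toFinset)
    fun x => (P.active {i} (Function.update 0 i x)).map fun k => k.fac i

/-- The finite ones among the infimum and the supremum of the domain of `m`. -/
def overallBounds (m : PiecewisePoly) : List ℝ :=
  [(m.map fun p => p.dom.lo).foldr min ⊤, (m.map fun p => p.dom.hi).foldr max ⊥].filterMap
    finitePart

/-- The boundary lines, in the form `x_i = slope * x_j + icpt`, of the literals of the factor
`{i, j}` that contain `x_i`, and those of the overall bounds of the message `m` from `i`. -/
def Problem.boundaryLines (P : Problem n) (i j : Fin n) (m : PiecewisePoly) : List Affine :=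
  (((P.literals {i, j}).filter fun l => l.coef i ≠ 0).map fun l =>
    (⟨-(l.coef j / l.coef i), l.rhs / l.coef i⟩ : Affine)) ++
  (overallBounds m).map fun b => ⟨0, b⟩

/-- The critical points for `x_j`: the crossings of boundary lines, and the bounds given by
literals that contain `x_j` only. -/
def Problem.criticalPoints (P : Problem n) (i j : Fin n) (m : PiecewisePoly) : Finset ℝ :=
  ((((P.literals {i, j}).filter fun l => l.coef i = 0 ∧ l.coef j ≠ 0).map fun l =>
      l.rhs / l.coef j) ++
    ((P.boundaryLines i j m).flatMap fun a =>
      (P.boundaryLines i j m).filterMap fun b => a.cross b)).toFinset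

/-- Strips and lines, from bottom to top, for boundary lines sorted from bottom to top. -/
def windowsFrom (l : Option Affine) : List Affine → List Window
  | [] => [Window.strip l none]
  | a :: as => Window.strip l (some a) :: Window.line a :: windowsFrom (some a) as

/-- The strips between boundary lines that are consecutive over `y`, and these lines. -/
def windowsAt (L : List Affine) (y : ℝ) : List Window :=
  windowsFrom none
    ((((L.map fun a => a.eval y).toFinset).sort (· ≤ ·)).filterMap fun v =>
      L.find? fun a => a.eval y = v)

/-- For a critical interval represented by its point `y`: one piecewise polynomial in `x_j` for
each feasible window, namely the polynomial in `x_j` of the active density piece, times the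
symbolic maximum over the window of its polynomial in `x_i` times the message from `i`. -/
def Problem.windowMaxima (P : Problem n) (i j : Fin n) (m : PiecewisePoly) (y : ℝ) :
    List PiecewisePoly :=
  (windowsAt (P.boundaryLines i j m) y).filterMap fun w =>
    (P.active {i, j} (Function.update (Function.update 0 j y) i (w.sample y))).map fun k =>
      scale (k.fac j) (maxOut (scale (k.fac i) m) w)

/-- The algorithm `compute-msgs`: the message from the factor `{i, j}` to `j`, given the message
`m` from `i` to this factor. -/
def Problem.computeMsg (P : Problem n) (i j : Fin n) (m : PiecewisePoly) : PiecewisePoly :=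
  (cells (P.criticalPoints i j m)).flatMap fun I =>
    restrictTo I (maxPieces (P.windowMaxima i j m I.sample))

/-! ### The upward pass -/

/-- A choice of a root in each connected component. -/
structure Rooting (G : SimpleGraph (Fin n)) where
  root : G.ConnectedComponent → Fin n
  root_mem : ∀ C, G.connectedComponentMk (root C) = C

/-- The distance of `i` from the root of its component. -/
def Rooting.depth {G : SimpleGraph (Fin n)} (R : Rooting G) (i : Fin n) : ℕ :=
  G.dist i (R.root (G.connectedComponentMk i))

/-- The children of `i`: its neighbours that are farther away from the root. -/
def Rooting.children {G : SimpleGraph (Fin n)} (R : Rooting G) (i : Fin n) : List (Fin n) :=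
  (List.finRange n).filter fun c => G.Adj c i ∧ R.depth c = R.depth i + 1

theorem Rooting.depth_lt {G : SimpleGraph (Fin n)} (R : Rooting G) (i : Fin n) :
    R.depth i < n := by
  have h : G.Reachable i (R.root (G.connectedComponentMk i)) :=
    (SimpleGraph.ConnectedComponent.exact (R.root_mem (G.connectedComponentMk i))).symm
  obtain ⟨p, hp, hl⟩ := h.exists_path_of_dist
  have := hp.length_lt
  rw [hl, Fintype.card_fin] at this
  exact this

/-- The message from variable `i` upwards (to the factor shared with its parent, or the final
message if `i` is a root): the product of the univariate factor of `i` and the messages from the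
factors shared with its children. -/
def Problem.upMsg (P : Problem n) (R : Rooting P.graph) (i : Fin n) : PiecewisePoly :=
  gatherMsgs (P.unaryMsg i ::
    (R.children i).attach.map fun c => P.computeMsg c.1 i (P.upMsg R c.1))
termination_by n - R.depth i
decreasing_by
  have hc := c.2
  simp only [Rooting.children, List.mem_filter, decide_eq_true_eq] at hc
  have := R.depth_lt c.1
  omega

/-- The total number of pieces of all messages of a run: from univariate factors to variables,
from variables to factors (for a root: the final message), and from bivariate factors to
variables. -/
def Problem.totalPieces (P : Problem n) (R : Rooting P.graph) : ℕ :=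
  ∑ i, ((P.unaryMsg i).length + (P.upMsg R i).length +
    ((R.children i).map fun c => (P.computeMsg c i (P.upMsg R c)).length).sum)

end

end MpMap

/-!
The bound is a count of break points; the meaning of the messages as suprema plays no role.

Every piecewise polynomial built by `assemble B` has at most `2 * B.card + 1` pieces, so it is
enough to bound sets of break points, most of which are roots of polynomials. If a message has `M`
pieces of degree at most `D`, then `maxOut` yields `O(M * D)` pieces (`length_maxOut_le`), and the
maximum over the `O(c)` windows of a critical interval has `O(c ^ 3 * M * D ^ 2)` pieces
(`length_maxPieces_le`). With `O(c ^ 2)` critical intervals, passing an edge multiplies the number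
of pieces by `O(c ^ 5 * D ^ 2)` (`Problem.length_computeMsg_le`).

Products of messages only add break points and degrees. As a vertex of a forest has only one
parent, these sums do not accumulate from level to level (`Rooting.sum_level_le`). This first
gives degrees of at most `D = 3 * n * q` (`Problem.degree_upMsg_le`), and then, with at most
`d + 1` levels, a total of `O((d + 1) * c * n * (K * c ^ 5 * (n * q) ^ 2) ^ d)` pieces for an
absolute constant `K` (`Problem.totalPieces_le`).

It remains to compare this with the claimed bound. Up to a constant to the power `d`, the number
`n ^ d` is at most `(n - d) ^ d * d!`, because `d ^ d ≤ 3 ^ d * d!`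
(`pow_le_pow_sub_mul_factorial`). Constants to the power `d` are absorbed by the factor `n ^ d` of
`(2 * n) ^ (d + 1)`, because `d < n` (`pow_le_pow_self_mul_pow`).
-/

namespace MpMap

noncomputable section

open scoped Classical

/-! ### Counting break points and pieces -/

theorem length_flatMap_le {α β : Type*} (L : List α) (f : α → List β) (k : ℕ)
    (h : ∀ x ∈ L, (f x).length ≤ k) : (L.flatMap f).length ≤ L.length * k := by
  rw [List.length_flatMap]
  simpa using List.sum_le_card_nsmul (L.map fun a => (f a).length) k (by simpa using h)

theorem card_toFinset_flatMap_le {α β : Type*} [DecidableEq β] (L : List α) (f : α → List β)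
    (k : ℕ) (h : ∀ x ∈ L, (f x).length ≤ k) : (L.flatMap f).toFinset.card ≤ L.length * k :=
  (List.toFinset_card_le _).trans (length_flatMap_le L f k h)

theorem length_cellsFrom (a : EReal) (l : List ℝ) : (cellsFrom a l).length = 2 * l.length + 1 := by
  induction l generalizing a with
  | nil => rfl
  | cons b bs ih => simp only [cellsFrom, List.length_cons, ih]; omega

theorem length_cells (B : Finset ℝ) : (cells B).length = 2 * B.card + 1 := by
  simp [cells, length_cellsFrom]

theorem length_simplify_le (q : PiecewisePoly) : (simplify q).length ≤ q.length := by
  induction q with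
  | nil => simp [simplify]
  | cons p ps ih =>
    unfold simplify
    split
    · simp
    · rename_i r rs h
      rw [h] at ih
      split_ifs <;> simp at ih ⊢ <;> omega

/-- All pieces of `q` have degree at most `N`. -/
def DegreeLE (q : PiecewisePoly) (N : ℕ) : Prop := ∀ p ∈ q, p.poly.natDegree ≤ N

theorem DegreeLE.simplify {q : PiecewisePoly} {N : ℕ} (h : DegreeLE q N) :
    DegreeLE (simplify q) N := by
  induction q with
  | nil => simpa [MpMap.simplify] using h
  | cons p ps ih =>
    have hp : p.poly.natDegree ≤ N := h p (by simp)
    have ih := ih fun x hx => h x (by simp [hx])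
    unfold MpMap.simplify
    split
    · intro x hx
      simp only [List.mem_singleton] at hx
      exact hx ▸ hp
    · rename_i r rs hr
      rw [hr] at ih
      split_ifs
      · intro x hx
        rcases List.mem_cons.1 hx with rfl | hx
        · exact hp
        · exact ih x (by simp [hx])
      · intro x hx
        rcases List.mem_cons.1 hx with rfl | hx
        · exact hp
        · exact ih x hx

theorem length_assemble_le (B : Finset ℝ) (f : ℝ → Option (Polynomial ℝ)) :
    (assemble B f).length ≤ 2 * B.card + 1 :=
  (length_simplify_le _).trans ((List.length_filterMap_le _ _).trans (length_cells B).le)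

theorem degreeLE_assemble (B : Finset ℝ) (f : ℝ → Option (Polynomial ℝ)) (N : ℕ)
    (h : ∀ y, ∀ p ∈ f y, p.natDegree ≤ N) : DegreeLE (assemble B f) N := by
  refine DegreeLE.simplify fun x hx => ?_
  simp only [List.mem_filterMap, Option.map_eq_some_iff] at hx
  obtain ⟨I, -, p, hp, rfl⟩ := hx
  exact h _ p hp

theorem card_breaks_le (q : PiecewisePoly) : (breaks q).card ≤ 2 * q.length := by
  rw [mul_comm]
  exact card_toFinset_flatMap_le _ _ 2 fun p _ => List.length_filterMap_le _ _

theorem card_filter_roots_le (p : Polynomial ℝ) (s : ℝ → Prop) [DecidablePred s] :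
    (p.roots.toFinset.filter s).toList.length ≤ p.natDegree := by
  rw [Finset.length_toList]
  exact (Finset.card_filter_le _ _).trans ((Multiset.toFinset_card_le _).trans p.card_roots')

theorem card_extremePoints_le {q : PiecewisePoly} {N : ℕ} (h : DegreeLE q N) :
    (extremePoints q).card ≤ q.length * N :=
  card_toFinset_flatMap_le _ _ N fun p hp => (card_filter_roots_le _ _).trans
    ((Polynomial.natDegree_derivative_le _).trans ((Nat.sub_le _ _).trans (h p hp)))

theorem natDegree_of_mem_map_find {q : PiecewisePoly} {N : ℕ} (h : DegreeLE q N)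
    (s : Piece → Bool) {p : Polynomial ℝ} (hp : p ∈ (q.find? s).map Piece.poly) :
    p.natDegree ≤ N := by
  obtain ⟨k, hk, rfl⟩ := Option.map_eq_some_iff.1 hp
  exact h k (List.mem_of_find?_eq_some hk)

theorem Affine.natDegree_comp_le (a : Affine) {p : Polynomial ℝ} {N : ℕ} (h : p.natDegree ≤ N) :
    (p.comp a.toPoly).natDegree ≤ N := by
  have : a.toPoly.natDegree ≤ 1 := Polynomial.natDegree_linear_le
  calc (p.comp a.toPoly).natDegree ≤ p.natDegree * a.toPoly.natDegree :=
        Polynomial.natDegree_comp_le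
    _ ≤ N * 1 := Nat.mul_le_mul h this
    _ = N := mul_one N

theorem natDegree_of_mem_dominating {L : List (Polynomial ℝ)} {N : ℕ}
    (h : ∀ p ∈ L, p.natDegree ≤ N) {y : ℝ} {p : Polynomial ℝ} (hp : p ∈ dominating L y) :
    p.natDegree ≤ N :=
  h p (List.argmax_mem hp)

/-! ### The symbolic maximum -/

theorem card_preimage_le (a : Affine) (B : Finset ℝ) : (a.preimage B).card ≤ B.card := by
  unfold Affine.preimage
  split_ifs
  · simp
  · exact Finset.card_image_le

theorem card_preimageOpt_le (a : Option Affine) (B : Finset ℝ) :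
    (preimageOpt a B).card ≤ B.card := by
  cases a with
  | none => simp [preimageOpt]
  | some a => exact card_preimage_le a B

theorem card_breaksBounds_le (l u : Option Affine) : (breaksBounds l u).card ≤ 1 := by
  unfold breaksBounds
  cases l.bind fun a => u.bind fun b => a.cross b <;> simp

theorem natDegree_of_mem_endPolys {q : PiecewisePoly} {N : ℕ} (h : DegreeLE q N)
    {l u : Option Affine} {y : ℝ} {p : Polynomial ℝ} (hp : p ∈ endPolys q l u y) :
    p.natDegree ≤ N := by
  unfold endPolys at hp
  split_ifs at hp
  · have hlo : ∀ p ∈ lowerEnd q l y, p.natDegree ≤ N := by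
      intro p hp
      unfold lowerEnd at hp
      split at hp
      · obtain ⟨r, hr, rfl⟩ := Option.map_eq_some_iff.1 hp
        exact Affine.natDegree_comp_le _ (natDegree_of_mem_map_find h _ hr)
      · exact natDegree_of_mem_map_find h _ hp
    have hup : ∀ p ∈ upperEnd q u y, p.natDegree ≤ N := by
      intro p hp
      unfold upperEnd at hp
      split at hp
      · obtain ⟨r, hr, rfl⟩ := Option.map_eq_some_iff.1 hp
        exact Affine.natDegree_comp_le _ (natDegree_of_mem_map_find h _ hr)
      · exact natDegree_of_mem_map_find h _ hp
    obtain ⟨o, ho, hop⟩ := List.mem_filterMap.1 hp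
    simp only [List.mem_cons, List.not_mem_nil, or_false] at ho
    rcases ho with rfl | rfl
    · exact hlo p hop
    · exact hup p hop
  · simp at hp

theorem card_breaksEnter_le {q : PiecewisePoly} {N : ℕ} (h : DegreeLE q N)
    (l u : Option Affine) : (breaksEnter q l u).card ≤ 2 * (q.length * N + 2 * q.length) := by
  have hE : (extremePoints q ∪ breaks q).card ≤ q.length * N + 2 * q.length :=
    (Finset.card_union_le _ _).trans (add_le_add (card_extremePoints_le h) (card_breaks_le q))
  have h1 := (card_preimageOpt_le l (extremePoints q ∪ breaks q)).trans hE
  have h2 := (card_preimageOpt_le u (extremePoints q ∪ breaks q)).trans hE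
  refine (Finset.card_union_le _ _).trans ?_
  omega

theorem card_breaksSwitch_le {q : PiecewisePoly} {N : ℕ} (h : DegreeLE q N)
    (l u : Option Affine) : (breaksSwitch q l u).card ≤ (8 * q.length + 3) * N := by
  refine (card_toFinset_flatMap_le _ _ N ?_).trans (Nat.mul_le_mul_right N ?_)
  · intro I _
    split
    · rename_i p r hpr
      have hp : p.natDegree ≤ N :=
        natDegree_of_mem_endPolys h (l := l) (u := u) (y := I.sample) (by rw [hpr]; simp)
      have hr : r.natDegree ≤ N :=
        natDegree_of_mem_endPolys h (l := l) (u := u) (y := I.sample) (by rw [hpr]; simp)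
      exact (card_filter_roots_le _ _).trans
        ((Polynomial.natDegree_sub_le _ _).trans (max_le hp hr))
    · simp
  · rw [length_cells]
    have h1 := (card_preimageOpt_le l (breaks q)).trans (card_breaks_le q)
    have h2 := (card_preimageOpt_le u (breaks q)).trans (card_breaks_le q)
    have h3 := card_breaksBounds_le l u
    have h4 := Finset.card_union_le (preimageOpt l (breaks q)) (preimageOpt u (breaks q))
    have h5 := Finset.card_union_le (preimageOpt l (breaks q) ∪ preimageOpt u (breaks q))
      (breaksBounds l u)
    omega

theorem card_breaksOuter_le {q : PiecewisePoly} {N : ℕ} (h : DegreeLE q N) (hN : 1 ≤ N)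
    (l u : Option Affine) : (breaksOuter q l u).card ≤ 14 * (q.length + 1) * N := by
  have h1 := card_breaksEnter_le h l u
  have h2 := card_breaksSwitch_le h l u
  have h3 := card_breaksBounds_le l u
  have h4 := Finset.card_union_le (breaksEnter q l u) (breaksSwitch q l u)
  have h5 : (breaksOuter q l u).card ≤ _ :=
    Finset.card_union_le (breaksEnter q l u ∪ breaksSwitch q l u) (breaksBounds l u)
  have h6 : q.length ≤ q.length * N := Nat.le_mul_of_pos_right _ hN
  nlinarith

theorem card_breaksCross_le (q : PiecewisePoly) (l u : Option Affine) :
    (breaksCross q l u).card ≤ 2 * (breaksOuter q l u).card + 1 :=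
  (List.toFinset_card_le _).trans
    ((List.length_filterMap_le _ _).trans (length_cells _).le)

/-- The number of pieces grows under `maxOut` by a single factor of the degree. -/
theorem length_maxOut_le {q : PiecewisePoly} {N : ℕ} (h : DegreeLE q N) (hN : 1 ≤ N)
    (w : Window) : (maxOut q w).length ≤ 87 * (q.length + 1) * N := by
  cases w with
  | strip l u =>
    have h1 := card_breaksOuter_le h hN l u
    have h2 := card_breaksCross_le q l u
    have h3 := Finset.card_union_le (breaksOuter q l u) (breaksCross q l u)
    unfold maxOut
    refine (length_assemble_le _ _).trans ?_
    nlinarith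
  | line a =>
    have h1 := (card_preimage_le a (breaks q)).trans (card_breaks_le q)
    unfold maxOut
    refine (length_assemble_le _ _).trans ?_
    nlinarith

theorem degreeLE_maxOut {q : PiecewisePoly} {N : ℕ} (h : DegreeLE q N) (w : Window) :
    DegreeLE (maxOut q w) N := by
  cases w with
  | strip l u =>
    unfold maxOut
    refine degreeLE_assemble _ _ N fun y p hp => natDegree_of_mem_dominating ?_ hp
    intro r hr
    rcases List.mem_append.1 hr with hr | hr
    · exact natDegree_of_mem_endPolys h hr
    · rw [Option.mem_toList, Option.map_eq_some_iff] at hr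
      obtain ⟨e, -, rfl⟩ := hr
      simp
  | line a =>
    unfold maxOut
    refine degreeLE_assemble _ _ N fun y p hp => ?_
    obtain ⟨r, hr, rfl⟩ := Option.map_eq_some_iff.1 hp
    exact Affine.natDegree_comp_le _ (natDegree_of_mem_map_find h _ hr)

theorem DegreeLE.scale {q : PiecewisePoly} {N M : ℕ} (h : DegreeLE q N) {r : Polynomial ℝ}
    (hr : r.natDegree ≤ M) : DegreeLE (scale r q) (M + N) := by
  intro p hp
  obtain ⟨k, hk, rfl⟩ := List.mem_map.1 hp
  exact Polynomial.natDegree_mul_le.trans (add_le_add hr (h k hk))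

/-! ### Pointwise maxima and products -/

theorem card_allBreaks_le (Q : List PiecewisePoly) :
    (allBreaks Q).card ≤ 2 * (Q.map List.length).sum := by
  refine (List.toFinset_card_le _).trans ?_
  rw [List.length_flatMap, ← List.sum_map_mul_left]
  exact List.sum_le_sum fun q _ => by
    rw [Finset.length_toList]; exact card_breaks_le q

theorem card_pairRoots_le {Q : List PiecewisePoly} {N w : ℕ} (hQ : ∀ q ∈ Q, DegreeLE q N)
    (hw : Q.length ≤ w) :
    (pairRoots Q).card ≤ (2 * (allBreaks Q).card + 1) * (w * (w * N)) := by
  unfold pairRoots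
  rw [← length_cells]
  refine card_toFinset_flatMap_le _ _ _ fun I _ => ?_
  have hlen : (Q.filterMap fun q => polyAt q I.sample).length ≤ w :=
    (List.length_filterMap_le _ _).trans hw
  have hdeg : ∀ p ∈ Q.filterMap fun q => polyAt q I.sample, p.natDegree ≤ N := by
    intro p hp
    obtain ⟨q, hq, hqp⟩ := List.mem_filterMap.1 hp
    exact natDegree_of_mem_map_find (hQ q hq) _ hqp
  refine (length_flatMap_le _ _ (w * N) fun p hp => ?_).trans (Nat.mul_le_mul_right _ hlen)
  refine (length_flatMap_le _ _ N fun r hr => ?_).trans (Nat.mul_le_mul_right _ hlen)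
  exact (card_filter_roots_le _ _).trans
    ((Polynomial.natDegree_sub_le _ _).trans (max_le (hdeg p hp) (hdeg r hr)))

/-- The maximum of `w` piecewise polynomials: every pair contributes up to `N` crossings on each
of the `O(w * ℓ)` cells. -/
theorem length_maxPieces_le {Q : List PiecewisePoly} {N w ℓ : ℕ}
    (hQ : ∀ q ∈ Q, DegreeLE q N ∧ q.length ≤ ℓ) (hQw : Q.length ≤ w)
    (hN : 1 ≤ N) (hw : 1 ≤ w) (hℓ : 1 ≤ ℓ) :
    (maxPieces Q).length ≤ 15 * (w ^ 3 * ℓ * N) := by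
  have h1 : (allBreaks Q).card ≤ 2 * (w * ℓ) := by
    refine (card_allBreaks_le Q).trans (Nat.mul_le_mul_left 2 ?_)
    have := List.sum_le_card_nsmul (Q.map List.length) ℓ
      (by simpa using fun q hq => (hQ q hq).2)
    simp only [List.length_map, smul_eq_mul] at this
    exact this.trans (Nat.mul_le_mul_right _ hQw)
  have h2 : (pairRoots Q).card ≤ (2 * (2 * (w * ℓ)) + 1) * (w * (w * N)) :=
    (card_pairRoots_le (fun q hq => (hQ q hq).1) hQw).trans (by gcongr)
  have h3 := Finset.card_union_le (allBreaks Q) (pairRoots Q)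
  refine (length_assemble_le _ _).trans ?_
  have e1 : w * ℓ ≤ w ^ 3 * ℓ * N :=
    (Nat.mul_le_mul_right ℓ (Nat.le_self_pow (by norm_num) w)).trans
      (Nat.le_mul_of_pos_right _ hN)
  have e2 : w * (w * N) ≤ w ^ 3 * ℓ * N := by
    calc w * (w * N) = w ^ 2 * 1 * N := by ring
      _ ≤ w ^ 3 * ℓ * N := by gcongr; norm_num
  have e3 : 1 ≤ w ^ 3 * ℓ * N := Nat.one_le_iff_ne_zero.2 (by positivity)
  have e4 : (2 * (2 * (w * ℓ)) + 1) * (w * (w * N)) =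
      4 * (w ^ 3 * ℓ * N) + w * (w * N) := by ring
  omega

theorem length_gatherMsgs_le (Q : List PiecewisePoly) :
    (gatherMsgs Q).length ≤ 4 * (Q.map List.length).sum + 1 := by
  have := card_allBreaks_le Q
  exact (length_assemble_le _ _).trans (by omega)

/-- A pointwise product has at most the sum of the degrees; the bounds for the factors are given
by a function `δ` on an index type. -/
theorem degreeLE_gatherMsgs {ι : Type*} (L : List ι) (m : ι → PiecewisePoly) (δ : ι → ℕ)
    (h : ∀ i ∈ L, DegreeLE (m i) (δ i)) (q : PiecewisePoly) (D : ℕ) (hq : DegreeLE q D) :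
    DegreeLE (gatherMsgs (q :: L.map m)) (D + (L.map δ).sum) := by
  refine degreeLE_assemble _ _ _ fun y p hp => ?_
  have key : ∀ L : List ι, (∀ i ∈ L, DegreeLE (m i) (δ i)) →
      ∀ p ∈ (L.map m).foldr (fun q acc => (polyAt q y).bind fun p => acc.map fun r => p * r)
        (some 1), p.natDegree ≤ (L.map δ).sum := by
    intro L
    induction L with
    | nil =>
      intro _ p hp
      simp only [List.map_nil, List.foldr_nil, Option.mem_def, Option.some.injEq] at hp
      simp [← hp]
    | cons i L ih =>
      intro h p hp
      simp only [List.map_cons, List.foldr_cons, Option.mem_def, Option.bind_eq_some_iff,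
        Option.map_eq_some_iff] at hp
      obtain ⟨a, ha, b, hb, rfl⟩ := hp
      rw [List.map_cons, List.sum_cons]
      exact Polynomial.natDegree_mul_le.trans (add_le_add
        (natDegree_of_mem_map_find (h i (by simp)) _ ha)
        (ih (fun j hj => h j (by simp [hj])) b hb))
  simp only [List.foldr_cons, Option.mem_def, Option.bind_eq_some_iff,
    Option.map_eq_some_iff] at hp
  obtain ⟨a, ha, b, hb, rfl⟩ := hp
  exact Polynomial.natDegree_mul_le.trans
    (add_le_add (natDegree_of_mem_map_find hq _ ha) (key L h b hb))

/-! ### The message from a bivariate factor -/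

variable {n : ℕ}

theorem Problem.natDegree_of_active (P : Problem n) {S : Finset (Fin n)} (hS : S ∈ P.factors)
    {x : Fin n → ℝ} {k : SepPiece n} (hk : k ∈ P.active S x) {s : Fin n} (hs : s ∈ S) :
    (k.fac s).natDegree ≤ P.maxDegree := by
  have hmem : k ∈ P.piecesOn S := by
    unfold Problem.active at hk
    split_ifs at hk
    · exact List.mem_of_find?_eq_some hk
    · simp at hk
  have hfold : ∀ l : List ℕ, ∀ a ∈ l, a ≤ l.foldr max 0 := by
    intro l
    induction l with
    | nil => simp
    | cons b l ih =>
      intro a ha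
      rcases List.mem_cons.1 ha with rfl | ha
      · exact le_max_left _ _
      · exact (ih a ha).trans (le_max_right _ _)
  calc (k.fac s).natDegree ≤ S.sup fun s => (k.fac s).natDegree :=
        Finset.le_sup (f := fun s => (k.fac s).natDegree) hs
    _ ≤ ((P.piecesOn S).map fun k => S.sup fun s => (k.fac s).natDegree).foldr max 0 :=
        hfold _ _ (List.mem_map.2 ⟨k, hmem, rfl⟩)
    _ ≤ P.maxDegree :=
        Finset.le_sup (f := fun S =>
          ((P.piecesOn S).map fun k => S.sup fun s => (k.fac s).natDegree).foldr max 0) hS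

theorem Problem.length_literals_le (P : Problem n) {S : Finset (Fin n)} (hS : S ∈ P.factors) :
    (P.literals S).length ≤ P.maxSize :=
  Finset.le_sup (f := P.size) hS

theorem Problem.singleton_mem_factors (P : Problem n) (i : Fin n) : {i} ∈ P.factors := by
  simp [Problem.factors]

theorem Problem.pair_mem_factors (P : Problem n) {i j : Fin n} (h : P.graph.Adj i j) :
    {i, j} ∈ P.factors := by
  simp only [Problem.factors, Finset.mem_filter, Finset.mem_univ, true_and]
  exact Or.inr ⟨i, j, h, rfl⟩

theorem Problem.length_unaryMsg_le (P : Problem n) (i : Fin n) :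
    (P.unaryMsg i).length ≤ 2 * P.maxSize + 1 := by
  refine (length_assemble_le _ _).trans ?_
  have h1 := (P.length_literals_le (P.singleton_mem_factors i))
  have h2 : ((((P.literals {i}).filter fun l => l.coef i ≠ 0).map
      fun l => l.rhs / l.coef i).toFinset).card ≤ (P.literals {i}).length := by
    refine (List.toFinset_card_le _).trans ?_
    rw [List.length_map]
    exact List.length_filter_le _ _
  omega

theorem Problem.degreeLE_unaryMsg (P : Problem n) (i : Fin n) :
    DegreeLE (P.unaryMsg i) P.maxDegree := by
  refine degreeLE_assemble _ _ _ fun y p hp => ?_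
  obtain ⟨k, hk, rfl⟩ := Option.map_eq_some_iff.1 hp
  exact P.natDegree_of_active (P.singleton_mem_factors i) hk (by simp)

theorem Problem.length_boundaryLines_le (P : Problem n) {i j : Fin n} (h : P.graph.Adj i j)
    (m : PiecewisePoly) : (P.boundaryLines i j m).length ≤ P.maxSize + 2 := by
  unfold Problem.boundaryLines
  rw [List.length_append, List.length_map, List.length_map]
  exact add_le_add ((List.length_filter_le _ _).trans (P.length_literals_le (P.pair_mem_factors h)))
    (List.length_filterMap_le _ _)

theorem Problem.card_criticalPoints_le (P : Problem n) {i j : Fin n} (h : P.graph.Adj i j)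
    (m : PiecewisePoly) :
    (P.criticalPoints i j m).card ≤ P.maxSize + (P.maxSize + 2) * (P.maxSize + 2) := by
  refine (List.toFinset_card_le _).trans ?_
  rw [List.length_append, List.length_map]
  have hL := P.length_boundaryLines_le h m
  refine add_le_add
    ((List.length_filter_le _ _).trans (P.length_literals_le (P.pair_mem_factors h))) ?_
  exact (length_flatMap_le _ _ (P.maxSize + 2) fun a _ =>
    (List.length_filterMap_le _ _).trans hL).trans (Nat.mul_le_mul_right _ hL)

theorem length_windowsFrom (l : Option Affine) (L : List Affine) :
    (windowsFrom l L).length = 2 * L.length + 1 := by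
  induction L generalizing l with
  | nil => rfl
  | cons a as ih => simp only [windowsFrom, List.length_cons, ih]; omega

theorem length_windowsAt_le (L : List Affine) (y : ℝ) :
    (windowsAt L y).length ≤ 2 * L.length + 1 := by
  unfold windowsAt
  rw [length_windowsFrom]
  have h1 := List.length_filterMap_le (fun v => L.find? fun a => a.eval y = v)
    (((L.map fun a => a.eval y).toFinset).sort (· ≤ ·))
  have h2 := List.toFinset_card_le (L.map fun a => a.eval y)
  rw [Finset.length_sort] at h1
  rw [List.length_map] at h2
  omega

theorem Problem.length_windowMaxima_le (P : Problem n) {i j : Fin n} (h : P.graph.Adj i j)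
    (m : PiecewisePoly) (y : ℝ) : (P.windowMaxima i j m y).length ≤ 2 * P.maxSize + 5 := by
  have h1 := P.length_boundaryLines_le h m
  have h2 := length_windowsAt_le (P.boundaryLines i j m) y
  exact (List.length_filterMap_le _ _).trans (by omega)

theorem Problem.windowMaxima_bounds (P : Problem n) {i j : Fin n} (h : P.graph.Adj i j)
    {m : PiecewisePoly} {N : ℕ} (hm : DegreeLE m N) {D : ℕ} (hD : 1 ≤ D)
    (hND : N + 2 * P.maxDegree ≤ D) (y : ℝ) :
    ∀ r ∈ P.windowMaxima i j m y,
      DegreeLE r (N + 2 * P.maxDegree) ∧ r.length ≤ 87 * (m.length + 1) * D := by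
  intro r hr
  obtain ⟨w, -, hw⟩ := List.mem_filterMap.1 hr
  obtain ⟨k, hk, rfl⟩ := Option.map_eq_some_iff.1 hw
  have hi := P.natDegree_of_active (P.pair_mem_factors h) hk (s := i) (by simp)
  have hj := P.natDegree_of_active (P.pair_mem_factors h) hk (s := j) (by simp)
  have h1 : DegreeLE (scale (k.fac i) m) (P.maxDegree + N) := hm.scale hi
  constructor
  · have := (degreeLE_maxOut h1 w).scale hj
    rwa [show N + 2 * P.maxDegree = P.maxDegree + (P.maxDegree + N) by ring]
  · have h2 : DegreeLE (scale (k.fac i) m) D := fun p hp => (h1 p hp).trans (by omega)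
    have := length_maxOut_le h2 hD w
    simpa [scale] using this

theorem degreeLE_maxPieces {Q : List PiecewisePoly} {N : ℕ} (hQ : ∀ q ∈ Q, DegreeLE q N) :
    DegreeLE (maxPieces Q) N := by
  refine degreeLE_assemble _ _ N fun y p hp => natDegree_of_mem_dominating ?_ hp
  intro r hr
  obtain ⟨q, hq, hqr⟩ := List.mem_filterMap.1 hr
  exact natDegree_of_mem_map_find (hQ q hq) _ hqr

theorem Problem.degreeLE_computeMsg (P : Problem n) {i j : Fin n} (h : P.graph.Adj i j)
    {m : PiecewisePoly} {N : ℕ} (hm : DegreeLE m N) :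
    DegreeLE (P.computeMsg i j m) (N + 2 * P.maxDegree) := by
  intro p hp
  obtain ⟨I, -, hI⟩ := List.mem_flatMap.1 hp
  obtain ⟨r, hr, rfl⟩ := List.mem_map.1 (List.mem_filter.1 hI).1
  exact degreeLE_maxPieces (fun q hq => (P.windowMaxima_bounds h hm
    (D := N + 2 * P.maxDegree + 1) (by omega) (by omega) _ q hq).1) r hr

/-- A step over an edge costs `c ^ 5 * D ^ 2`: there are `O(c ^ 2)` critical intervals, and over
each of them a maximum of `O(c)` results of `maxOut` with `O(M * D)` pieces each, whose
pairwise crossings number `O(c ^ 3 * M * D ^ 2)`. -/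
theorem Problem.length_computeMsg_le (P : Problem n) {i j : Fin n} (h : P.graph.Adj i j)
    {m : PiecewisePoly} {N c D : ℕ} (hm : DegreeLE m N) (hc : 1 ≤ c) (hPc : P.maxSize ≤ c)
    (hD : 1 ≤ D) (hND : N + 2 * P.maxDegree ≤ D) :
    (P.computeMsg i j m).length ≤
      21 * (15 * (343 * 87)) * (c ^ 5 * D ^ 2) * (m.length + 1) := by
  have hcells : (cells (P.criticalPoints i j m)).length ≤ 21 * c ^ 2 := by
    rw [length_cells]
    have := P.card_criticalPoints_le h m
    have h2 : (P.maxSize + 2) * (P.maxSize + 2) ≤ (3 * c) * (3 * c) := by gcongr <;> omega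
    have h3 : c ≤ c ^ 2 := Nat.le_self_pow (by norm_num) c
    have h4 : (3 * c) * (3 * c) = 9 * c ^ 2 := by ring
    omega
  calc (P.computeMsg i j m).length
      ≤ (cells (P.criticalPoints i j m)).length *
          (15 * ((7 * c) ^ 3 * (87 * (m.length + 1) * D) * D)) := by
        refine length_flatMap_le _ _ _ fun I _ => ?_
        refine (List.length_filter_le _ _).trans ?_
        rw [List.length_map]
        refine length_maxPieces_le (fun r hr => ?_) ?_ hD (by omega)
          (Nat.one_le_iff_ne_zero.2 (by positivity))
        · have hb := P.windowMaxima_bounds h hm hD hND _ r hr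
          exact ⟨fun p hp => (hb.1 p hp).trans hND, hb.2⟩
        · exact (P.length_windowMaxima_le h m _).trans (by omega)
    _ ≤ (21 * c ^ 2) * (15 * ((7 * c) ^ 3 * (87 * (m.length + 1) * D) * D)) := by gcongr
    _ = 21 * (15 * (343 * 87)) * (c ^ 5 * D ^ 2) * (m.length + 1) := by ring

/-! ### Summation over the levels of a rooted forest -/

theorem Rooting.mem_children {G : SimpleGraph (Fin n)} (R : Rooting G) {i c : Fin n} :
    c ∈ R.children i ↔ G.Adj c i ∧ R.depth c = R.depth i + 1 := by
  simp [Rooting.children]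

/-- In a forest, a vertex has at most one parent: two parents would give two shortest paths to
the root. -/
theorem Rooting.parent_unique {G : SimpleGraph (Fin n)} (hG : G.IsAcyclic) (R : Rooting G)
    {i j c : Fin n} (hi : c ∈ R.children i) (hj : c ∈ R.children j) : i = j := by
  have key : ∀ k, c ∈ R.children k →
      ∃ p : G.Walk c (R.root (G.connectedComponentMk c)), p.IsPath ∧ p.snd = k := by
    intro k hk
    obtain ⟨hadj, hdepth⟩ := R.mem_children.1 hk
    have hcomp : G.connectedComponentMk k = G.connectedComponentMk c :=
      SimpleGraph.ConnectedComponent.sound hadj.reachable.symm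
    unfold Rooting.depth at hdepth
    rw [hcomp] at hdepth
    have hreach : G.Reachable k (R.root (G.connectedComponentMk c)) :=
      SimpleGraph.ConnectedComponent.exact (by rw [R.root_mem, hcomp])
    obtain ⟨p, hp⟩ := hreach.exists_walk_length_eq_dist
    refine ⟨SimpleGraph.Walk.cons hadj p, ?_, by simp⟩
    apply SimpleGraph.Walk.isPath_of_length_eq_dist
    rw [SimpleGraph.Walk.length_cons, hp, hdepth]
  obtain ⟨p, hp, rfl⟩ := key i hi
  obtain ⟨r, hr, rfl⟩ := key j hj
  have : (⟨p, hp⟩ : G.Path _ _) = ⟨r, hr⟩ :=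
    (hG.subsingleton_path _ _).elim _ _
  rw [Subtype.mk.injEq] at this
  rw [this]

theorem Rooting.sum_children {G : SimpleGraph (Fin n)} (R : Rooting G) (A : Fin n → ℕ)
    (i : Fin n) : ((R.children i).map A).sum = ∑ c ∈ (R.children i).toFinset, A c :=
  (List.sum_toFinset A ((List.nodup_finRange n).filter _)).symm

/-- If `A i` is at most a weight `w i` plus `g` times the sum of `A` over the children of `i`,
then the sum of `A` over a level is at most the total weight times `g` to the number of levels
below. No factor for the number of vertices arises, since the children are counted only once. -/
theorem Rooting.sum_level_le {G : SimpleGraph (Fin n)} (hG : G.IsAcyclic) (R : Rooting G)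
    (A w : Fin n → ℕ) {g d : ℕ} (hg : 1 ≤ g) (hd : ∀ i, R.depth i ≤ d)
    (hA : ∀ i, A i ≤ w i + g * ((R.children i).map A).sum) (t k : ℕ) (htk : t + k = d) :
    ∑ i with R.depth i = t, A i ≤ (∑ i with t ≤ R.depth i, w i) * g ^ k := by
  have hstep : ∀ t, ∑ i with R.depth i = t, A i ≤
      ∑ i with R.depth i = t, w i + g * ∑ i with R.depth i = t + 1, A i := by
    intro t
    calc ∑ i with R.depth i = t, A i
        ≤ ∑ i with R.depth i = t, (w i + g * ∑ c ∈ (R.children i).toFinset, A c) :=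
          Finset.sum_le_sum fun i _ => by rw [← R.sum_children]; exact hA i
      _ = ∑ i with R.depth i = t, w i +
            g * ∑ i with R.depth i = t, ∑ c ∈ (R.children i).toFinset, A c := by
          rw [Finset.sum_add_distrib, Finset.mul_sum]
      _ ≤ _ := by
          gcongr
          rw [← Finset.sum_biUnion]
          · refine Finset.sum_le_sum_of_subset fun c hc => ?_
            obtain ⟨i, hi, hc⟩ := Finset.mem_biUnion.1 hc
            have := (R.mem_children.1 (List.mem_toFinset.1 hc)).2
            simp only [Finset.mem_filter, Finset.mem_univ, true_and] at hi ⊢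
            omega
          · intro i _ j _ hij
            refine Finset.disjoint_left.2 fun c hci hcj => hij ?_
            exact R.parent_unique hG (List.mem_toFinset.1 hci) (List.mem_toFinset.1 hcj)
  induction k generalizing t with
  | zero =>
    have hempty : ∑ i with R.depth i = t + 1, A i = 0 := by
      refine Finset.sum_eq_zero fun i hi => ?_
      have := hd i
      simp only [Finset.mem_filter, Finset.mem_univ, true_and] at hi
      omega
    have h := hstep t
    rw [hempty, mul_zero, add_zero] at h
    rw [pow_zero, mul_one]
    refine h.trans (Finset.sum_le_sum_of_subset fun i hi => ?_)
    simp only [Finset.mem_filter, Finset.mem_univ, true_and] at hi ⊢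
    omega
  | succ k ih =>
    have h1 := ih (t + 1) (by omega)
    have hsplit : ∑ i with t ≤ R.depth i, w i =
        ∑ i with R.depth i = t, w i + ∑ i with t + 1 ≤ R.depth i, w i := by
      rw [← Finset.sum_union]
      · congr 1
        ext i
        simp only [Finset.mem_filter, Finset.mem_univ, true_and, Finset.mem_union]
        omega
      · refine Finset.disjoint_left.2 fun i hi hi' => ?_
        simp only [Finset.mem_filter, Finset.mem_univ, true_and] at hi hi'
        omega
    calc ∑ i with R.depth i = t, A i
        ≤ ∑ i with R.depth i = t, w i + g * ∑ i with R.depth i = t + 1, A i := hstep t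
      _ ≤ (∑ i with R.depth i = t, w i) * g ^ (k + 1) +
            g * ((∑ i with t + 1 ≤ R.depth i, w i) * g ^ k) := by
          gcongr
          exact Nat.le_mul_of_pos_right _ (by positivity)
      _ = _ := by rw [hsplit]; ring

theorem Rooting.sum_level_le_sum {G : SimpleGraph (Fin n)} (hG : G.IsAcyclic) (R : Rooting G)
    (A w : Fin n → ℕ) {g d : ℕ} (hg : 1 ≤ g) (hd : ∀ i, R.depth i ≤ d)
    (hA : ∀ i, A i ≤ w i + g * ((R.children i).map A).sum) {t : ℕ} (ht : t ≤ d) :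
    ∑ i with R.depth i = t, A i ≤ (∑ i, w i) * g ^ d :=
  (R.sum_level_le hG A w hg hd hA t (d - t) (by omega)).trans (Nat.mul_le_mul
    (Finset.sum_le_sum_of_subset (Finset.filter_subset _ _))
    (Nat.pow_le_pow_right hg (Nat.sub_le d t)))

/-! ### Degrees and pieces of the messages -/

/-- The largest degree of the pieces. -/
def degree (q : PiecewisePoly) : ℕ := q.toFinset.sup fun p => p.poly.natDegree

theorem degreeLE_iff {q : PiecewisePoly} {N : ℕ} : DegreeLE q N ↔ degree q ≤ N := by
  simp [DegreeLE, degree, Finset.sup_le_iff]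

theorem Problem.degree_upMsg_le_children (P : Problem n) (R : Rooting P.graph) (i : Fin n) :
    degree (P.upMsg R i) ≤ P.maxDegree +
      ((R.children i).map fun c => degree (P.upMsg R c) + 2 * P.maxDegree).sum := by
  rw [← degreeLE_iff, Problem.upMsg]
  have h := degreeLE_gatherMsgs (R.children i).attach
    (fun c => P.computeMsg c.1 i (P.upMsg R c.1))
    (fun c => degree (P.upMsg R c.1) + 2 * P.maxDegree)
    (fun c _ => P.degreeLE_computeMsg (R.mem_children.1 c.2).1 (degreeLE_iff.2 le_rfl))
    _ _ (P.degreeLE_unaryMsg i)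
  rwa [List.attach_map_val (f := fun c => degree (P.upMsg R c) + 2 * P.maxDegree)] at h

/-- The degree of a message is at most the sum of the degrees of all factors below it. -/
theorem Problem.degree_upMsg_le (P : Problem n) (hP : P.graph.IsAcyclic) (R : Rooting P.graph)
    (i : Fin n) : degree (P.upMsg R i) + 2 * P.maxDegree ≤ 3 * n * P.maxDegree := by
  have h := R.sum_level_le_sum hP (fun i => degree (P.upMsg R i) + 2 * P.maxDegree)
    (fun _ => 3 * P.maxDegree) (g := 1) (d := n) le_rfl (fun i => (R.depth_lt i).le)
    (fun i => by have := P.degree_upMsg_le_children R i; omega) (R.depth_lt i).le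
  have h' := Finset.single_le_sum (f := fun i => degree (P.upMsg R i) + 2 * P.maxDegree)
    (fun _ _ => Nat.zero_le _) (show i ∈ Finset.univ.filter fun j => R.depth j = R.depth i by simp)
  refine (h'.trans h).trans (le_of_eq ?_)
  simp
  ring

/-- The number of pieces of the messages whose computation is charged to `i`. -/
def Problem.localPieces (P : Problem n) (R : Rooting P.graph) (i : Fin n) : ℕ :=
  (P.unaryMsg i).length + (P.upMsg R i).length +
    ((R.children i).map fun c => (P.computeMsg c i (P.upMsg R c)).length).sum

theorem Problem.length_upMsg_le (P : Problem n) (R : Rooting P.graph) (i : Fin n) :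
    (P.upMsg R i).length ≤ 4 * ((P.unaryMsg i).length +
      ((R.children i).map fun c => (P.computeMsg c i (P.upMsg R c)).length).sum) + 1 := by
  rw [Problem.upMsg]
  refine (length_gatherMsgs_le _).trans (le_of_eq ?_)
  rw [List.map_cons, List.sum_cons, List.map_map]
  congr 4
  exact List.attach_map_val (f := fun c => (P.computeMsg c i (P.upMsg R c)).length)

theorem Problem.localPieces_le (P : Problem n) (hP : P.graph.IsAcyclic) (R : Rooting P.graph)
    {c q : ℕ} (hc : 1 ≤ c) (hPc : P.maxSize ≤ c) (hq : 1 ≤ q) (hPq : P.maxDegree ≤ q)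
    (i : Fin n) :
    P.localPieces R i + 1 ≤ 17 * c +
      5 * (21 * (15 * (343 * 87)) * (c ^ 5 * (3 * n * q) ^ 2)) *
        ((R.children i).map fun j => P.localPieces R j + 1).sum := by
  -- `F` is the growth over one edge of `length_computeMsg_le`, for degrees up to `3 * n * q`.
  set F := 21 * (15 * (343 * 87)) * (c ^ 5 * (3 * n * q) ^ 2) with hF
  have h1 := P.length_unaryMsg_le i
  have h2 := P.length_upMsg_le R i
  have h3 : ((R.children i).map fun j => (P.computeMsg j i (P.upMsg R j)).length).sum ≤
      F * ((R.children i).map fun j => P.localPieces R j + 1).sum := by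
    rw [← List.sum_map_mul_left]
    refine List.sum_le_sum fun j hj => ?_
    have hn : 1 ≤ n := Nat.one_le_iff_ne_zero.2 (by rintro rfl; exact j.elim0)
    have hdeg : degree (P.upMsg R j) + 2 * P.maxDegree ≤ 3 * n * q :=
      (P.degree_upMsg_le hP R j).trans (Nat.mul_le_mul_left _ hPq)
    have hlen : (P.upMsg R j).length + 1 ≤ P.localPieces R j + 1 := by
      unfold Problem.localPieces; omega
    exact (P.length_computeMsg_le (R.mem_children.1 hj).1 (degreeLE_iff.2 le_rfl) hc hPc
      (Nat.one_le_iff_ne_zero.2 (by positivity)) hdeg).trans (Nat.mul_le_mul_left _ hlen)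
  rw [mul_assoc 5 F]
  unfold Problem.localPieces at h3 ⊢
  omega

theorem Rooting.depth_le_diameter {G : SimpleGraph (Fin n)} (R : Rooting G) (i : Fin n) :
    R.depth i ≤ diameter G :=
  Finset.le_sup (f := fun p : Fin n × Fin n => G.dist p.1 p.2)
    (Finset.mem_univ (i, R.root (G.connectedComponentMk i)))

theorem diameter_lt (G : SimpleGraph (Fin n)) (hn : 1 ≤ n) : diameter G < n := by
  refine (Finset.sup_lt_iff (by exact hn)).2 fun p _ => ?_
  by_cases h : G.Reachable p.1 p.2
  · obtain ⟨w, hw, hl⟩ := h.exists_path_of_dist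
    have := hw.length_lt
    rwa [hl, Fintype.card_fin] at this
  · rw [SimpleGraph.dist_eq_zero_of_not_reachable h]
    exact hn

theorem Problem.totalPieces_le (P : Problem n) (hP : P.graph.IsAcyclic) (R : Rooting P.graph)
    (hn : 1 ≤ n) {c q : ℕ} (hc : 1 ≤ c) (hPc : P.maxSize ≤ c) (hq : 1 ≤ q)
    (hPq : P.maxDegree ≤ q) :
    P.totalPieces R ≤ (diameter P.graph + 1) * (n * (17 * c) *
      (5 * (21 * (15 * (343 * 87)) * (c ^ 5 * (3 * n * q) ^ 2))) ^ diameter P.graph) := by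
  have hlevel := fun t ht => R.sum_level_le_sum hP (fun i => P.localPieces R i + 1)
    (fun _ => 17 * c) (g := 5 * (21 * (15 * (343 * 87)) * (c ^ 5 * (3 * n * q) ^ 2)))
    (d := diameter P.graph) (Nat.one_le_iff_ne_zero.2 (by positivity)) R.depth_le_diameter
    (fun i => P.localPieces_le hP R hc hPc hq hPq i) (t := t) ht
  calc P.totalPieces R ≤ ∑ i, (P.localPieces R i + 1) :=
        Finset.sum_le_sum fun i _ => Nat.le_succ _
    _ = ∑ t ∈ Finset.range (diameter P.graph + 1),
          ∑ i with R.depth i = t, (P.localPieces R i + 1) :=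
        (Finset.sum_fiberwise_of_maps_to
          (fun i _ => Finset.mem_range.2 (Nat.lt_succ_of_le (R.depth_le_diameter i))) _).symm
    _ ≤ _ := by
        refine (Finset.sum_le_card_nsmul _ _ _ fun t ht =>
          hlevel t (Nat.lt_succ_iff.1 (Finset.mem_range.1 ht))).trans (le_of_eq ?_)
        simp

/-! ### Comparison of the bounds -/

theorem pow_self_le_three_pow_mul_factorial (d : ℕ) : d ^ d ≤ 3 ^ d * d.factorial := by
  have h := Real.pow_div_factorial_le_exp (d : ℝ) (Nat.cast_nonneg d) d
  rw [div_le_iff₀ (by positivity)] at h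
  have h3 : Real.exp d ≤ 3 ^ d := by
    rw [← Real.exp_one_pow]
    exact pow_le_pow_left₀ (Real.exp_pos 1).le Real.exp_one_lt_three.le d
  have h4 : (d : ℝ) ^ d ≤ 3 ^ d * d.factorial := h.trans (by gcongr)
  exact_mod_cast h4

/-- Either `n - d` or `d` is at least `n / 2`. -/
theorem pow_le_pow_sub_mul_factorial {n d : ℕ} (hd : d < n) :
    n ^ d ≤ 6 ^ d * ((n - d) ^ d * d.factorial) := by
  rcases le_total d (n - d) with h | h
  · calc n ^ d ≤ (2 * (n - d)) ^ d := Nat.pow_le_pow_left (by omega) d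
      _ = 2 ^ d * ((n - d) ^ d * 1) := by ring
      _ ≤ 6 ^ d * ((n - d) ^ d * d.factorial) := by
          gcongr
          · norm_num
          · exact Nat.one_le_iff_ne_zero.2 d.factorial_ne_zero
  · calc n ^ d ≤ (2 * d) ^ d := Nat.pow_le_pow_left (by omega) d
      _ = 2 ^ d * d ^ d := mul_pow _ _ _
      _ ≤ 2 ^ d * (3 ^ d * (1 * d.factorial)) := by
          rw [one_mul]
          exact Nat.mul_le_mul_left _ (pow_self_le_three_pow_mul_factorial d)
      _ ≤ 2 ^ d * (3 ^ d * ((n - d) ^ d * d.factorial)) := by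
          gcongr
          exact Nat.one_le_pow _ _ (by omega)
      _ = 6 ^ d * ((n - d) ^ d * d.factorial) := by
          rw [← mul_assoc, ← mul_pow]; norm_num

/-- A constant per level is absorbed by `n ^ d`: if `n ≤ K`, also `d ≤ K`. -/
theorem pow_le_pow_self_mul_pow {n d : ℕ} (K : ℕ) (hK : 1 ≤ K) (hd : d < n) :
    K ^ d ≤ K ^ K * n ^ d := by
  rcases le_total K n with h | h
  · exact (Nat.pow_le_pow_left h d).trans (Nat.le_mul_of_pos_left _ (by positivity))
  · exact (Nat.pow_le_pow_right hK (by omega)).trans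
      (Nat.le_mul_of_pos_right _ (Nat.pow_pos (by omega)))

/-- The bound of `Problem.totalPieces_le`, with a factor `k` per edge, against the product form in
`(n - d) ^ (2 * d) * (d !) ^ 2`. The factor `d + 1` for the levels is at most `2 ^ d`. -/
theorem levelwise_bound_le {n d : ℕ} (c q k : ℕ) (hk : 1 ≤ k) (hd : d < n) :
    (d + 1) * (n * (17 * c) * (5 * (k * (c ^ 5 * (3 * n * q) ^ 2))) ^ d) ≤
      17 * (2 * (5 * k * 9) * 36) ^ (2 * (5 * k * 9) * 36) *
        (c ^ (5 * d + 1) * (n - d) ^ (2 * d) * q ^ (2 * d) * (2 * n) ^ (d + 1) *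
          d.factorial ^ 2) := by
  set K := 2 * (5 * k * 9) * 36 with hK
  have h1 : d + 1 ≤ 2 ^ d := Nat.succ_le_of_lt Nat.lt_two_pow_self
  have h2 := pow_le_pow_sub_mul_factorial hd
  have h3 := pow_le_pow_self_mul_pow K (by omega) hd
  calc (d + 1) * (n * (17 * c) * (5 * (k * (c ^ 5 * (3 * n * q) ^ 2))) ^ d)
      ≤ 2 ^ d * (n * (17 * c) * (5 * (k * (c ^ 5 * (3 * n * q) ^ 2))) ^ d) := by gcongr
    _ = 17 * (c * (c ^ 5) ^ d) * n * (q ^ d) ^ 2 * (2 * (5 * k * 9)) ^ d * (n ^ d) ^ 2 := by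
        simp only [mul_pow]
        rw [show (9 : ℕ) ^ d = (3 ^ 2) ^ d by norm_num]
        ring
    _ ≤ 17 * (c * (c ^ 5) ^ d) * n * (q ^ d) ^ 2 * (2 * (5 * k * 9)) ^ d *
          (6 ^ d * ((n - d) ^ d * d.factorial)) ^ 2 := by gcongr
    _ = 17 * c ^ (5 * d + 1) * n * q ^ (2 * d) * K ^ d *
          ((n - d) ^ (2 * d) * d.factorial ^ 2) := by
        rw [hK, mul_pow _ 36, show (36 : ℕ) ^ d = (6 ^ d) ^ 2 by
          rw [← pow_mul, mul_comm, pow_mul]; norm_num]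
        ring
    _ ≤ 17 * c ^ (5 * d + 1) * n * q ^ (2 * d) * (K ^ K * n ^ d) *
          ((n - d) ^ (2 * d) * d.factorial ^ 2) := by gcongr
    _ = 17 * K ^ K * (c ^ (5 * d + 1) * (n - d) ^ (2 * d) * q ^ (2 * d) * n ^ (d + 1) *
          d.factorial ^ 2) := by ring
    _ ≤ _ := by
        gcongr
        omega

end

end MpMap

theorem mainTheorem3 :
    ∃ C : ℕ, ∀ (n : ℕ) (P : MpMap.Problem n), P.graph.IsAcyclic →
      ∀ (R : MpMap.Rooting P.graph) (c d q : ℕ),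
        c = max 1 P.maxSize → d = MpMap.diameter P.graph → q = max 1 P.maxDegree →
          P.totalPieces R ≤
            C * (c ^ (5 * d + 1) * (n - d) ^ (2 * d) * q ^ (2 * d) * (2 * n) ^ (d + 1) *
              (Nat.factorial d) ^ 2) := by
  -- The factor for one edge is generalized, so that the constant is never evaluated.
  obtain ⟨k, hk⟩ : ∃ k : ℕ, k = 21 * (15 * (343 * 87)) := ⟨_, rfl⟩
  refine ⟨17 * (2 * (5 * k * 9) * 36) ^ (2 * (5 * k * 9) * 36), ?_⟩
  rintro n P hP R c d q hc rfl hq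
  rcases Nat.eq_zero_or_pos n with rfl | hn
  · simp [MpMap.Problem.totalPieces]
  · have h := P.totalPieces_le hP R hn (c := c) (q := q) (by omega) (by omega) (by omega)
      (by omega)
    rw [← hk] at h
    exact h.trans (MpMap.levelwise_bound_le c q k (by omega) (MpMap.diameter_lt _ hn))
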